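/- Let $n\ge 1$. Consider a labeled rooted tree $T$ with vertex set $[n]=\{1,\dots,n\}$ and edges oriented toward the root, and a sequence $s=(s_1,\dots,s_n)\in[n]^n$ of preferred parking spots. Drivers $1,\dots,n$ arrive one by one; driver $i$ parks at the first unoccupied vertex on the directed path from $s_i$ to the root ($s_i$ included), and leaves without parking if there is none. The sequence $s$ is a *parking function on $T$* if all $n$ drivers park. For a vertex $v$, let $T_v$ be the subtree on all vertices $u$ from which there is a directed path (possibly of length $0$) to $v$. A parking function $s$ on $T$ is *prime* if $|T_v|<|\{i: s_i\in T_v\}|$ for every non-root vertex $v$. Then the number $P_n$ of pairs $(T,p)$, where $T$ is a labeled rooted tree with vertex set $[n]$ and $p$ is a prime parking function on $T$, is $$P_n=(2n-2)!.$$ Moreover, a parking function $s$ on $T$ is prime if and only if every edge of $T$ is used by $s$, that is, crossed by some driver who failed to park at her preferred spot and is searching for an unoccupied one. -/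

import Mathlib

/-- A labeled rooted tree with vertex set `Fin n` (standing for `[n]`) and edges oriented towards
the root.  Every non-root vertex `v` has exactly one outgoing edge `v → parent v`, and following
these edges leads from every vertex to the root.  The root has no outgoing edge; the field
`parent_root` only fixes a value of `parent` there, so that distinct terms are distinct trees. -/
structure LabeledRootedTree (n : ℕ) where
  root : Fin n
  parent : Fin n → Fin n
  parent_root : parent root = root
  reaches_root : ∀ v : Fin n, ∃ k : ℕ, parent^[k] v = root

namespace LabeledRootedTree

/-- `v ≼ w`: there is a directed path (possibly of length zero) from `v` to `w` in `T`. -/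
def Below {n : ℕ} (T : LabeledRootedTree n) (v w : Fin n) : Prop :=
  ∃ k : ℕ, T.parent^[k] v = w

/-- The vertex set of the subtree `T_v`. -/
def subtree {n : ℕ} (T : LabeledRootedTree n) (v : Fin n) : Set (Fin n) :=
  {u | T.Below u v}

open Classical in
/-- The first spot outside `occ` on the directed path from `v` to the root, or `none` if all
spots of that path lie in `occ`. -/
noncomputable def firstFree {n : ℕ} (T : LabeledRootedTree n) (occ : Finset (Fin n)) (v : Fin n) :
    Option (Fin n) :=
  if h : ∃ k : ℕ, T.parent^[k] v ∉ occ then some (T.parent^[Nat.find h] v) else none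

/-- The set of occupied spots after the first `i` drivers of the preference sequence `s` have
made their attempts to park, one after the other. -/
noncomputable def occupied {n : ℕ} (T : LabeledRootedTree n) (s : Fin n → Fin n) :
    ℕ → Finset (Fin n)
  | 0 => ∅
  | i + 1 =>
    if h : i < n then
      match T.firstFree (T.occupied s i) (s ⟨i, h⟩) with
      | some w => insert w (T.occupied s i)
      | none => T.occupied s i
    else T.occupied s i

/-- The spot where driver `i` parks, or `none` if she leaves the tree without parking. -/
noncomputable def parkingSpot {n : ℕ} (T : LabeledRootedTree n) (s : Fin n → Fin n)
    (i : Fin n) : Option (Fin n) :=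
  T.firstFree (T.occupied s i) (s i)

/-- `s` is a parking function on `T`: all `n` drivers park. -/
def IsParkingFunction {n : ℕ} (T : LabeledRootedTree n) (s : Fin n → Fin n) : Prop :=
  ∀ i : Fin n, ∃ w : Fin n, T.parkingSpot s i = some w

/-- `s` is a prime parking function on `T`: it is a parking function, and every subtree `T_v` at
a non-root vertex `v` is preferred by strictly more drivers than it has vertices. -/
def IsPrimeParkingFunction {n : ℕ} (T : LabeledRootedTree n) (s : Fin n → Fin n) : Prop :=
  T.IsParkingFunction s ∧
    ∀ v : Fin n, v ≠ T.root → (T.subtree v).ncard < {i : Fin n | s i ∈ T.subtree v}.ncard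

/-- The edge `u → parent u` (for a non-root vertex `u`) is used by `s`: some driver `i`, after
failing to park at her preferred spot, crosses it during her search, that is, she passes
through `u` and finds every spot from `s i` up to and including `u` occupied. -/
def EdgeUsed {n : ℕ} (T : LabeledRootedTree n) (s : Fin n → Fin n) (u : Fin n) : Prop :=
  u ≠ T.root ∧ ∃ (i : Fin n) (k : ℕ), T.parent^[k] (s i) = u ∧
    ∀ j ≤ k, T.parent^[j] (s i) ∈ T.occupied s i

end LabeledRootedTree

/-- The set of pairs `(T, p)` where `T` is a labeled rooted tree on `n` vertices and `p` is a
prime parking function on `T`. -/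
def primeParkingFunctions (n : ℕ) : Set (LabeledRootedTree n × (Fin n → Fin n)) :=
  {x | x.1.IsPrimeParkingFunction x.2}

/-! Hang every driver as a leaf on her preferred spot, and let the excess of a node be the number of
drivers minus the number of spots below it. Primality says that every node except the root has
excess at least 1; these inequalities, with excess 0 at the root, already force everybody to park.
So pairs (T, p) are the same as "prime loads" with n spots and n drivers
(`isPrimeParkingFunction_iff_isPrimeLoad`, `primeParkingFunctionsEquiv`).

Allowing m ≠ n drivers makes the class recursive: a prime load is a root spot with a set of
branches, each an overloaded tree. Cutting off the branch of a chosen driver gives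
`mul_numPrimeLoad`. Let t mark spots and y excess, let B be the exponential series of overloaded
trees and F that of prime loads times y. The recurrence is F = t exp(B) in differentiated form
(`loadSeries_logDeriv_y`, `loadSeries_logDeriv_t`). Conversely, an overloaded tree is a prime load
of positive excess or a lone driver, so F = t + y(B + P - y) with P(t) the balanced prime loads
(`loadSeries_eq`).

The kernel method then works modulo F - y. Comparing y-derivatives gives B + P = 2y, hence y = t +
y²; comparing t-derivatives gives y = t + yg with g = tP'. So g = y, and g = t + g² because no y is
left: g is t times the Catalan series, and its coefficients give (2n-2)!.

The edge criterion is separate: exactly |T_u| drivers end up in T_u, all of whom preferred T_u, so a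
surplus means a driver who left T_u through the edge at u. -/

/-- The order relation of a finite rooted tree whose greatest element is the root. -/
structure IsTreeOrder {N : Type*} (r : N → N → Prop) : Prop where
  refl : ∀ a, r a a
  antisymm : ∀ a b, r a b → r b a → a = b
  trans : ∀ a b c, r a b → r b c → r a c
  chain : ∀ a b c, r a b → r a c → r b c ∨ r c b
  exists_top : ∃ t, ∀ a, r a t

open Classical in
/-- The number of elements below `u` satisfying `c` (the drivers) minus the number of the other
elements below `u` (the parking spots). -/
noncomputable def excess {N : Type*} [Fintype N] (c : N → Prop) (r : N → N → Prop) (u : N) : ℤ :=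
  ∑ a, if r a u then (if c a then 1 else -1) else 0

/-- A tree of spots and drivers, with drivers as leaves, in which every node has positive
excess. -/
structure IsOverloaded {N : Type*} [Fintype N] (c : N → Prop) (r : N → N → Prop) : Prop where
  tree : IsTreeOrder r
  minimal : ∀ d, c d → ∀ a, r a d → a = d
  excess_pos : ∀ u, 1 ≤ excess c r u

/-- A tree of spots and drivers, with drivers as leaves and a spot as root, in which every node
other than the root has positive excess. -/
structure IsPrimeLoad {N : Type*} [Fintype N] (c : N → Prop) (r : N → N → Prop) : Prop where
  tree : IsTreeOrder r
  minimal : ∀ d, c d → ∀ a, r a d → a = d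
  not_top : ∀ d, c d → ¬ ∀ a, r a d
  excess_pos : ∀ u, (¬ ∀ a, r a u) → 1 ≤ excess c r u

/-- `S` is the set of nodes below some child of the root. -/
structure IsBranch {N : Type*} (r : N → N → Prop) (S : Finset N) : Prop where
  exists_max : ∃ v ∈ S, ∀ a ∈ S, r a v
  exists_top : ∃ t, t ∉ S ∧ ∀ a, r a t
  lower : ∀ a b, a ∉ S → b ∈ S → ¬ r a b
  eq_top : ∀ a b, a ∈ S → b ∉ S → r a b → ∀ x, r x b

open Classical in
/-- Attach the root of a tree on `S` to the root of a tree on the complement of `S`. -/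
def glue {N : Type*} (S : Finset N) (r₁ : {x // x ∈ S} → {x // x ∈ S} → Prop)
    (r₂ : {x // x ∉ S} → {x // x ∉ S} → Prop) (a b : N) : Prop :=
  if ha : a ∈ S then
    if hb : b ∈ S then r₁ ⟨a, ha⟩ ⟨b, hb⟩ else ∀ x, r₂ x ⟨b, hb⟩
  else
    if hb : b ∈ S then False else r₂ ⟨a, ha⟩ ⟨b, hb⟩

/-! ### Cutting a branch off a tree and gluing it back -/

section Glue

variable {N : Type*} {S : Finset N} {r₁ : {x // x ∈ S} → {x // x ∈ S} → Prop}
  {r₂ : {x // x ∉ S} → {x // x ∉ S} → Prop}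

@[simp] lemma glue_mem_mem (a b : {x // x ∈ S}) : glue S r₁ r₂ a b ↔ r₁ a b := by
  simp [glue]

@[simp] lemma glue_mem_notMem (a : {x // x ∈ S}) (b : {x // x ∉ S}) :
    glue S r₁ r₂ a b ↔ ∀ x, r₂ x b := by
  simp [glue, b.2]

@[simp] lemma glue_notMem_mem (a : {x // x ∉ S}) (b : {x // x ∈ S}) :
    ¬ glue S r₁ r₂ a b := by
  simp [glue, a.2]

@[simp] lemma glue_notMem_notMem (a b : {x // x ∉ S}) : glue S r₁ r₂ a b ↔ r₂ a b := by
  simp [glue, a.2, b.2]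

lemma forall_iff_mem_notMem {S : Finset N} {p : N → Prop} :
    (∀ a, p a) ↔ (∀ a : {x // x ∈ S}, p a) ∧ ∀ a : {x // x ∉ S}, p a :=
  ⟨fun h => ⟨fun a => h a, fun a => h a⟩, fun h a => by
    by_cases ha : a ∈ S
    · exact h.1 ⟨a, ha⟩
    · exact h.2 ⟨a, ha⟩⟩

lemma glue_top_iff (b : {x // x ∉ S}) : (∀ a, glue S r₁ r₂ a b) ↔ ∀ x, r₂ x b := by
  rw [forall_iff_mem_notMem (S := S)]
  simp only [glue_mem_notMem, glue_notMem_notMem]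
  exact ⟨fun h => h.2, fun h => ⟨fun _ => h, h⟩⟩

lemma IsTreeOrder.glue (h₁ : IsTreeOrder r₁) (h₂ : IsTreeOrder r₂) :
    IsTreeOrder (glue S r₁ r₂) where
  refl := by
    simp only [forall_iff_mem_notMem (S := S), glue_mem_mem, glue_notMem_notMem]
    exact ⟨h₁.refl, h₂.refl⟩
  antisymm := by
    simp only [forall_iff_mem_notMem (S := S), glue_mem_mem, glue_notMem_notMem, glue_notMem_mem,
      glue_mem_notMem, Subtype.coe_inj]
    exact ⟨fun a => ⟨h₁.antisymm a, by simp⟩, fun a => ⟨by simp, h₂.antisymm a⟩⟩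
  trans := by
    simp only [forall_iff_mem_notMem (S := S), glue_mem_mem, glue_notMem_notMem, glue_notMem_mem,
      glue_mem_notMem]
    exact ⟨fun a => ⟨fun b => ⟨h₁.trans a b, fun c _ h => h⟩, fun b => ⟨by simp,
        fun c h h' x => h₂.trans _ _ _ (h x) h'⟩⟩,
      fun a => ⟨by simp, fun b => ⟨by simp, h₂.trans a b⟩⟩⟩
  chain := by
    simp only [forall_iff_mem_notMem (S := S), glue_mem_mem, glue_notMem_notMem, glue_notMem_mem,
      glue_mem_notMem]
    exact ⟨fun a => ⟨fun b => ⟨h₁.chain a b, fun c _ h => Or.inl h⟩,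
        fun b => ⟨fun c h _ => Or.inr h, fun c _ h' => Or.inl (h' b)⟩⟩,
      fun a => ⟨by simp, fun b => ⟨by simp, h₂.chain a b⟩⟩⟩
  exists_top := by
    obtain ⟨t, ht⟩ := h₂.exists_top
    exact ⟨t, (glue_top_iff t).2 ht⟩

lemma IsBranch.glue (h₁ : IsTreeOrder r₁) (h₂ : IsTreeOrder r₂) : IsBranch (glue S r₁ r₂) S where
  exists_max := by
    obtain ⟨v, hv⟩ := h₁.exists_top
    exact ⟨v, v.2, fun a ha => (glue_mem_mem ⟨a, ha⟩ v).2 (hv _)⟩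
  exists_top := by
    obtain ⟨t, ht⟩ := h₂.exists_top
    exact ⟨t, t.2, (glue_top_iff t).2 ht⟩
  lower a b ha hb := glue_notMem_mem ⟨a, ha⟩ ⟨b, hb⟩
  eq_top a b ha hb h := (glue_top_iff ⟨b, hb⟩).2 ((glue_mem_notMem ⟨a, ha⟩ ⟨b, hb⟩).1 h)

lemma IsBranch.not_top {r : N → N → Prop} (hS : IsBranch r S) {u : N} (hu : u ∈ S) :
    ¬ ∀ a, r a u := by
  obtain ⟨t, ht, -⟩ := hS.exists_top
  exact fun h => hS.lower t u ht hu (h t)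

lemma IsBranch.top_iff {r : N → N → Prop} (hr : IsTreeOrder r) (hS : IsBranch r S)
    (u : {x // x ∉ S}) : (∀ a, r a u) ↔ ∀ a : {x // x ∉ S}, r a u := by
  obtain ⟨t, ht, ht'⟩ := hS.exists_top
  refine ⟨fun h a => h a, fun h a => hr.trans _ _ _ (ht' a) (h ⟨t, ht⟩)⟩

variable [Fintype N] [DecidableEq N] {c : N → Prop}

lemma excess_eq_add (S : Finset N) (r : N → N → Prop) (u : N) : excess c r u =
    (∑ a : {x // x ∈ S}, open Classical in if r a u then (if c a then 1 else -1) else 0) +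
    ∑ a : {x // x ∉ S}, open Classical in if r a u then (if c a then 1 else -1) else 0 := by
  rw [excess]
  convert (Fintype.sum_subtype_add_sum_subtype (fun x => x ∈ S) _).symm

lemma excess_mem {r : N → N → Prop} (hr : ∀ a b, a ∉ S → b ∈ S → ¬ r a b) (u : {x // x ∈ S}) :
    excess c r u = excess (fun x : {x // x ∈ S} => c x) (fun a b => r a b) u := by
  rw [excess_eq_add S, Finset.sum_eq_zero (s := (Finset.univ : Finset {x // x ∉ S})), add_zero,
    excess]
  intro a _
  rw [if_neg (hr a u a.2 u.2)]

lemma excess_notMem {r : N → N → Prop} (u : {x // x ∉ S}) (hr : ∀ a ∈ S, ¬ r a u) :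
    excess c r u = excess (fun x : {x // x ∉ S} => c x) (fun a b => r a b) u := by
  rw [excess_eq_add S, Finset.sum_eq_zero (s := (Finset.univ : Finset {x // x ∈ S})), zero_add,
    excess]
  intro a _
  rw [if_neg (hr a a.2)]

/-- A node other than the root sees below it only nodes of its own part, so its excess is unchanged.
Only the root gains descendants, and its excess is unconstrained. -/
lemma IsPrimeLoad.glue (h₁ : IsOverloaded (fun x : {x // x ∈ S} => c x) r₁)
    (h₂ : IsPrimeLoad (fun x : {x // x ∉ S} => c x) r₂) : IsPrimeLoad c (glue S r₁ r₂) where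
  tree := h₁.tree.glue h₂.tree
  minimal := by
    simp only [forall_iff_mem_notMem (S := S), glue_mem_mem, glue_notMem_notMem, glue_notMem_mem,
      glue_mem_notMem, Subtype.coe_inj]
    exact ⟨fun d hd => ⟨h₁.minimal d hd, by simp⟩,
      fun d hd => ⟨fun a h => (h₂.not_top d hd h).elim, h₂.minimal d hd⟩⟩
  not_top := by
    rw [forall_iff_mem_notMem (S := S)]
    refine ⟨fun d hd h => ?_, fun d hd h => h₂.not_top d hd ((glue_top_iff d).1 h)⟩
    obtain ⟨t, -⟩ := h₂.tree.exists_top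
    exact glue_notMem_mem t d (h t)
  excess_pos := by
    rw [forall_iff_mem_notMem (S := S)]
    refine ⟨fun u _ => ?_, fun u hu => ?_⟩
    · rw [excess_mem fun a b ha hb => glue_notMem_mem ⟨a, ha⟩ ⟨b, hb⟩]
      simpa using h₁.excess_pos u
    · rw [glue_top_iff] at hu
      rw [excess_notMem u fun a ha => (glue_mem_notMem ⟨a, ha⟩ u).not.2 hu]
      simpa using h₂.excess_pos u hu

lemma IsBranch.isOverloaded {r : N → N → Prop} (hr : IsPrimeLoad c r) (hS : IsBranch r S) :
    IsOverloaded (fun x : {x // x ∈ S} => c x) (fun a b => r a b) where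
  tree :=
    { refl := fun a => hr.tree.refl a
      antisymm := fun a b h h' => Subtype.ext (hr.tree.antisymm _ _ h h')
      trans := fun a b c => hr.tree.trans a b c
      chain := fun a b c => hr.tree.chain a b c
      exists_top := by
        obtain ⟨v, hv, h⟩ := hS.exists_max
        exact ⟨⟨v, hv⟩, fun a => h a a.2⟩ }
  minimal d hd a h := Subtype.ext (hr.minimal d hd a h)
  excess_pos u := by
    rw [← excess_mem hS.lower]
    exact hr.excess_pos _ (hS.not_top u.2)

lemma IsBranch.isPrimeLoad {r : N → N → Prop} (hr : IsPrimeLoad c r) (hS : IsBranch r S) :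
    IsPrimeLoad (fun x : {x // x ∉ S} => c x) (fun a b => r a b) where
  tree :=
    { refl := fun a => hr.tree.refl a
      antisymm := fun a b h h' => Subtype.ext (hr.tree.antisymm _ _ h h')
      trans := fun a b c => hr.tree.trans a b c
      chain := fun a b c => hr.tree.chain a b c
      exists_top := by
        obtain ⟨t, ht, h⟩ := hS.exists_top
        exact ⟨⟨t, ht⟩, fun a => h a⟩ }
  minimal d hd a h := Subtype.ext (hr.minimal d hd a h)
  not_top d hd h := hr.not_top d hd ((hS.top_iff hr.tree d).2 h)
  excess_pos u hu := by
    rw [← hS.top_iff hr.tree] at hu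
    rw [← excess_notMem u fun a ha h => hu (hS.eq_top a u ha u.2 h)]
    exact hr.excess_pos _ hu

/-- Cutting off a given branch. -/
def branchEquiv (c : N → Prop) (S : Finset N) :
    {r : N → N → Prop // IsPrimeLoad c r ∧ IsBranch r S} ≃
      {r : {x // x ∈ S} → {x // x ∈ S} → Prop // IsOverloaded (fun x : {x // x ∈ S} => c x) r} ×
      {r : {x // x ∉ S} → {x // x ∉ S} → Prop // IsPrimeLoad (fun x : {x // x ∉ S} => c x) r} where
  toFun r := (⟨fun a b => r.1 a b, r.2.2.isOverloaded r.2.1⟩,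
    ⟨fun a b => r.1 a b, r.2.2.isPrimeLoad r.2.1⟩)
  invFun r := ⟨glue S r.1.1 r.2.1, IsPrimeLoad.glue r.1.2 r.2.2,
    IsBranch.glue r.1.2.tree r.2.2.tree⟩
  left_inv := by
    rintro ⟨r, hr, hS⟩
    ext a b
    dsimp only
    revert a b
    simp only [forall_iff_mem_notMem (S := S), glue_mem_mem, glue_notMem_notMem, glue_notMem_mem,
      glue_mem_notMem, implies_true, true_and, and_true, false_iff]
    refine ⟨fun a b => ?_, fun a b => hS.lower a b a.2 b.2⟩
    rw [← hS.top_iff hr.tree]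
    exact ⟨fun h => h a, hS.eq_top a b a.2 b.2⟩
  right_inv := by
    rintro ⟨⟨r₁, h₁⟩, ⟨r₂, h₂⟩⟩
    simp

end Glue

/-! ### Every driver lies in exactly one branch: double counting -/

lemma IsPrimeLoad.existsUnique_branch {N : Type*} [Fintype N] {c : N → Prop} {r : N → N → Prop}
    (hr : IsPrimeLoad c r) {d : N}
    (hd : c d) : ∃! S : Finset N, IsBranch r S ∧ d ∈ S := by
  classical
  obtain ⟨t, ht⟩ := hr.tree.exists_top
  have ht_iff : ∀ u, (∀ a, r a u) ↔ u = t := fun u =>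
    ⟨fun h => hr.tree.antisymm _ _ (ht u) (h t), fun h => h ▸ ht⟩
  -- The child of the root above `d`: the ancestors of `d` form a chain, and its last element before
  -- the root is the one with the most nodes below it. The branch is the set of nodes below `v`.
  obtain ⟨v, hv, hmax⟩ : ∃ v, (r d v ∧ v ≠ t) ∧ ∀ u, r d u ∧ u ≠ t → r u v := by
    let s : Finset N := Finset.univ.filter fun u => r d u ∧ u ≠ t
    have hs : s.Nonempty := ⟨d, by
      simpa [s] using ⟨hr.tree.refl d, fun h => hr.not_top d hd ((ht_iff d).2 h)⟩⟩
    obtain ⟨v, hv, hmax⟩ := s.exists_max_image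
      (fun u => (Finset.univ.filter fun a => r a u).card) hs
    simp only [s, Finset.mem_filter, Finset.mem_univ, true_and] at hv hmax
    refine ⟨v, hv, fun u hu => ?_⟩
    rcases hr.tree.chain _ _ _ hu.1 hv.1 with h | h
    · exact h
    · have hsub : (Finset.univ.filter fun a => r a v) ⊆ Finset.univ.filter fun a => r a u := by
        intro a
        simpa using fun ha => hr.tree.trans _ _ _ ha h
      have := Finset.eq_of_subset_of_card_le hsub (hmax u hu)
      have hu' : u ∈ Finset.univ.filter fun a => r a u := by simpa using hr.tree.refl u
      rw [← this] at hu'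
      simpa using hu'
  refine ⟨Finset.univ.filter fun a => r a v, ⟨⟨⟨v, ?_, ?_⟩, ⟨t, ?_, ht⟩, ?_, ?_⟩, ?_⟩, ?_⟩
  · simpa using hr.tree.refl v
  · simp
  · simpa using fun h => hv.2 (hr.tree.antisymm _ _ (ht v) h)
  · simpa using fun a b ha hb h => ha (hr.tree.trans _ _ _ h hb)
  · simp only [Finset.mem_filter, Finset.mem_univ, true_and]
    intro a b ha hb h
    rw [ht_iff]
    by_contra hbt
    rcases hr.tree.chain _ _ _ ha h with h' | h'
    · exact hb (hmax b ⟨hr.tree.trans _ _ _ hv.1 h', hbt⟩)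
    · exact hb h'
  · simpa using hv.1
  · rintro S ⟨hS, hdS⟩
    obtain ⟨w, hw, hwmax⟩ := hS.exists_max
    have hwv : r w v := hmax w ⟨hwmax d hdS, fun h => hS.not_top hw ((ht_iff w).2 h)⟩
    have hvS : v ∈ S := by
      by_contra hvS
      exact hv.2 ((ht_iff v).1 (hS.eq_top w v hw hvS hwv))
    ext a
    simp only [Finset.mem_filter, Finset.mem_univ, true_and]
    refine ⟨fun ha => hr.tree.trans _ _ _ (hwmax a ha) hwv, fun ha => ?_⟩
    by_contra haS
    exact hS.lower a v haS hvS ha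

/-- The number of overloaded trees. -/
noncomputable def cardOverloaded {N : Type*} [Fintype N] (c : N → Prop) : ℕ :=
  Nat.card {r : N → N → Prop // IsOverloaded c r}

/-- The number of prime loads. -/
noncomputable def cardPrimeLoad {N : Type*} [Fintype N] (c : N → Prop) : ℕ :=
  Nat.card {r : N → N → Prop // IsPrimeLoad c r}

open Classical in
-- Count pairs of a prime load and one of its drivers, sorted by the branch `S` containing the
-- driver; `branchEquiv` counts the prime loads having `S` as a branch.
lemma card_driver_mul_cardPrimeLoad {N : Type*} [Fintype N] [DecidableEq N] (c : N → Prop) :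
    (Finset.univ.filter c).card * cardPrimeLoad c =
      ∑ S : Finset N, (S.filter c).card *
        (cardOverloaded (fun x : {x // x ∈ S} => c x) *
          cardPrimeLoad (fun x : {x // x ∉ S} => c x)) := by
  have key (r : {r : N → N → Prop // IsPrimeLoad c r}) : (Finset.univ.filter c).card =
      ∑ S : Finset N, if IsBranch r.1 S then (S.filter c).card else 0 := by
    have h1 : ∀ S : Finset N, (if IsBranch r.1 S then (S.filter c).card else 0) =
        ∑ d ∈ Finset.univ.filter c, if IsBranch r.1 S ∧ d ∈ S then 1 else 0 := by
      intro S
      split_ifs with h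
      · rw [Finset.sum_boole]
        simp only [h, true_and, Nat.cast_id, Finset.filter_filter]
        congr 1
        ext d
        simp [and_comm]
      · simp [h]
    simp_rw [h1]
    rw [Finset.sum_comm, Finset.card_eq_sum_ones]
    refine Finset.sum_congr rfl fun d hd => ?_
    obtain ⟨S, hS, huniq⟩ := r.2.existsUnique_branch (Finset.mem_filter.1 hd).2
    rw [Finset.sum_eq_single S (fun S' _ hne => if_neg fun h => hne (huniq S' h)) (by simp),
      if_pos hS]
  have h2 (S : Finset N) : cardOverloaded (fun x : {x // x ∈ S} => c x) *
      cardPrimeLoad (fun x : {x // x ∉ S} => c x) =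
      ∑ r : {r : N → N → Prop // IsPrimeLoad c r}, if IsBranch r.1 S then 1 else 0 := by
    rw [cardOverloaded, cardPrimeLoad, ← Nat.card_prod, ← Nat.card_congr (branchEquiv c S),
      Finset.sum_boole, Nat.cast_id, ← Fintype.card_subtype, ← Nat.card_eq_fintype_card]
    exact Nat.card_congr (Equiv.subtypeSubtypeEquivSubtypeInter _ _).symm
  simp_rw [h2, Finset.mul_sum]
  rw [Finset.sum_comm, cardPrimeLoad, Nat.card_eq_fintype_card, mul_comm, ← smul_eq_mul,
    ← Finset.card_univ, ← Finset.sum_const]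
  refine Finset.sum_congr rfl fun r _ => ?_
  rw [key r]
  simp

/-! ### Invariance under relabelling -/

lemma IsTreeOrder.comap {N N' : Type*} {r : N' → N' → Prop} (e : N ≃ N') (h : IsTreeOrder r) :
    IsTreeOrder fun a b => r (e a) (e b) where
  refl a := h.refl _
  antisymm a b hab hba := e.injective (h.antisymm _ _ hab hba)
  trans a b c := h.trans _ _ _
  chain a b c := h.chain _ _ _
  exists_top := by
    obtain ⟨t, ht⟩ := h.exists_top
    exact ⟨e.symm t, fun a => by simpa using ht _⟩

section Transport

variable {N N' : Type*} [Fintype N] [Fintype N'] {c : N' → Prop} {r : N' → N' → Prop}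

lemma excess_comap (e : N ≃ N') (u : N) :
    excess (fun a => c (e a)) (fun a b => r (e a) (e b)) u = excess c r (e u) := by
  rw [excess, excess, ← e.sum_comp]

lemma IsPrimeLoad.comap (e : N ≃ N') (h : IsPrimeLoad c r) :
    IsPrimeLoad (fun a => c (e a)) fun a b => r (e a) (e b) where
  tree := h.tree.comap e
  minimal d hd a had := e.injective (h.minimal _ hd _ had)
  not_top d hd hd' := h.not_top _ hd (e.forall_congr_right.1 hd')
  excess_pos u hu := by
    rw [excess_comap]
    exact h.excess_pos _ fun h' => hu fun a => h' _

lemma IsOverloaded.comap (e : N ≃ N') (h : IsOverloaded c r) :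
    IsOverloaded (fun a => c (e a)) fun a b => r (e a) (e b) where
  tree := h.tree.comap e
  minimal d hd a had := e.injective (h.minimal _ hd _ had)
  excess_pos u := by
    rw [excess_comap]
    exact h.excess_pos _

lemma cardPrimeLoad_congr {c : N → Prop} {c' : N' → Prop} (e : N ≃ N')
    (h : ∀ a, c' (e a) ↔ c a) : cardPrimeLoad c = cardPrimeLoad c' := by
  obtain rfl : c = fun a => c' (e a) := funext fun a => propext (h a).symm
  refine Nat.card_congr
    { toFun := fun r => ⟨fun a b => r.1 (e.symm a) (e.symm b), ?_⟩
      invFun := fun r => ⟨fun a b => r.1 (e a) (e b), r.2.comap e⟩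
      left_inv := fun r => by simp
      right_inv := fun r => by simp }
  simpa using r.2.comap e.symm

lemma cardOverloaded_congr {c : N → Prop} {c' : N' → Prop} (e : N ≃ N')
    (h : ∀ a, c' (e a) ↔ c a) : cardOverloaded c = cardOverloaded c' := by
  obtain rfl : c = fun a => c' (e a) := funext fun a => propext (h a).symm
  refine Nat.card_congr
    { toFun := fun r => ⟨fun a b => r.1 (e.symm a) (e.symm b), ?_⟩
      invFun := fun r => ⟨fun a b => r.1 (e a) (e b), r.2.comap e⟩
      left_inv := fun r => by simp
      right_inv := fun r => by simp }
  simpa using r.2.comap e.symm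

lemma exists_equiv_sum_fin (c : N → Prop) [DecidablePred c] :
    ∃ e : N ≃ Fin (Fintype.card {a // ¬ c a}) ⊕ Fin (Fintype.card {a // c a}),
      ∀ a, (e a).isRight = true ↔ c a := by
  refine ⟨(Equiv.sumCompl c).symm.trans ((Equiv.sumComm _ _).trans
    ((Fintype.equivFin _).sumCongr (Fintype.equivFin _))), fun a => ?_⟩
  by_cases h : c a
  · simp [h, Equiv.sumCompl_symm_apply_of_pos]
  · simp [h, Equiv.sumCompl_symm_apply_of_neg]

end Transport

/-! ### Numbers of trees: recurrence and boundary values -/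

/-- The number of prime loads with `n` spots and `m` drivers. -/
noncomputable def numPrimeLoad (n m : ℕ) : ℕ :=
  cardPrimeLoad fun a : Fin n ⊕ Fin m => a.isRight = true

/-- The number of overloaded trees with `n` spots and `m` drivers. -/
noncomputable def numOverloaded (n m : ℕ) : ℕ :=
  cardOverloaded fun a : Fin n ⊕ Fin m => a.isRight = true

lemma cardPrimeLoad_eq {N : Type*} [Fintype N] (c : N → Prop) [DecidablePred c] :
    cardPrimeLoad c = numPrimeLoad (Fintype.card {a // ¬ c a}) (Fintype.card {a // c a}) := by
  obtain ⟨e, he⟩ := exists_equiv_sum_fin c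
  exact cardPrimeLoad_congr e he

lemma cardOverloaded_eq {N : Type*} [Fintype N] (c : N → Prop) [DecidablePred c] :
    cardOverloaded c = numOverloaded (Fintype.card {a // ¬ c a}) (Fintype.card {a // c a}) := by
  obtain ⟨e, he⟩ := exists_equiv_sum_fin c
  exact cardOverloaded_congr e he

lemma card_subtype_subtype {N : Type*} {p q : N → Prop} [Fintype {x : {x // p x} // q x}]
    {F : Finset N} (h : ∀ x, x ∈ F ↔ p x ∧ q x) :
    Fintype.card {x : {x // p x} // q x} = F.card := by
  rw [← Fintype.card_coe]
  exact Fintype.card_congr ((Equiv.subtypeSubtypeEquivSubtypeInter p q).trans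
    (Equiv.subtypeEquivRight fun a => (h a).symm))

lemma mul_numPrimeLoad (n m : ℕ) : m * numPrimeLoad n m =
    ∑ i ∈ Finset.range (n + 1), ∑ j ∈ Finset.range (m + 1), n.choose i * m.choose j *
      (j * (numOverloaded i j * numPrimeLoad (n - i) (m - j))) := by
  have h := card_driver_mul_cardPrimeLoad fun a : Fin n ⊕ Fin m => a.isRight = true
  have h1 : (Finset.univ.filter fun a : Fin n ⊕ Fin m => a.isRight = true).card = m := by
    simp only [Finset.card_filter, Fintype.sum_sum_type]
    simp
  have h2 (S : Finset (Fin n ⊕ Fin m)) :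
      (S.filter fun a => a.isRight = true).card = S.toRight.card := by
    conv_lhs => rw [← Finset.toLeft_disjSum_toRight (u := S)]
    simp only [Finset.card_filter, Finset.sum_disjSum]
    simp
  have h2' (S : Finset (Fin n ⊕ Fin m)) :
      (S.filter fun a => ¬ a.isRight = true).card = S.toLeft.card := by
    conv_lhs => rw [← Finset.toLeft_disjSum_toRight (u := S)]
    simp only [Finset.card_filter, Finset.sum_disjSum]
    simp
  have h3 (S : Finset (Fin n ⊕ Fin m)) :
      cardOverloaded (fun x : {x // x ∈ S} => x.1.isRight = true) =
        numOverloaded S.toLeft.card S.toRight.card := by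
    rw [cardOverloaded_eq, ← h2, ← h2']
    congr 1
    · exact card_subtype_subtype (p := fun a => a ∈ S) (q := fun a => ¬ a.isRight = true) (by simp)
    · exact card_subtype_subtype (p := fun a => a ∈ S) (q := fun a => a.isRight = true) (by simp)
  have h4 (S : Finset (Fin n ⊕ Fin m)) :
      cardPrimeLoad (fun x : {x // x ∉ S} => x.1.isRight = true) =
        numPrimeLoad (n - S.toLeft.card) (m - S.toRight.card) := by
    have hl : Sᶜ.toLeft = S.toLeftᶜ := by ext; simp
    have hr : Sᶜ.toRight = S.toRightᶜ := by ext; simp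
    have hl' : n - S.toLeft.card = Sᶜ.toLeft.card := by simp [hl, Finset.card_compl]
    have hr' : m - S.toRight.card = Sᶜ.toRight.card := by simp [hr, Finset.card_compl]
    rw [cardPrimeLoad_eq, hl', hr', ← h2, ← h2']
    congr 1
    · exact card_subtype_subtype (p := fun a => a ∉ S) (q := fun a => ¬ a.isRight = true) (by simp)
    · exact card_subtype_subtype (p := fun a => a ∉ S) (q := fun a => a.isRight = true) (by simp)
  have h5 : m * numPrimeLoad n m = ∑ S : Finset (Fin n ⊕ Fin m), S.toRight.card *
      (numOverloaded S.toLeft.card S.toRight.card *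
        numPrimeLoad (n - S.toLeft.card) (m - S.toRight.card)) := by
    simp_rw [← h3, ← h4, ← h2]
    convert h
    convert h1.symm
    rfl
  rw [h5, ← Finset.sumEquiv.symm.toEquiv.sum_comp, Fintype.sum_prod_type]
  simp only [OrderIso.coe_toEquiv, Finset.sumEquiv_symm_apply, Finset.toLeft_disjSum,
    Finset.toRight_disjSum]
  have h6 (k : ℕ) (f : ℕ → ℕ) : ∑ s : Finset (Fin k), f s.card =
      ∑ i ∈ Finset.range (k + 1), k.choose i * f i := by
    simpa using Finset.sum_powerset_apply_card f (x := (Finset.univ : Finset (Fin k)))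
  rw [h6 n fun i => ∑ t : Finset (Fin m), t.card * (numOverloaded i t.card *
    numPrimeLoad (n - i) (m - t.card))]
  refine Finset.sum_congr rfl fun i _ => ?_
  rw [h6 m fun j => j * (numOverloaded i j * numPrimeLoad (n - i) (m - j)), Finset.mul_sum]
  exact Finset.sum_congr rfl fun j _ => (mul_assoc _ _ _).symm

lemma excess_top {n m : ℕ} {r : Fin n ⊕ Fin m → Fin n ⊕ Fin m → Prop} {u : Fin n ⊕ Fin m}
    (h : ∀ a, r a u) : excess (fun a => a.isRight = true) r u = m - n := by
  simp [excess, h]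
  ring

lemma numOverloaded_of_le {n m : ℕ} (h : m ≤ n) : numOverloaded n m = 0 := by
  rw [numOverloaded, cardOverloaded, Nat.card_eq_zero]
  refine Or.inl ⟨fun ⟨r, hr⟩ => ?_⟩
  obtain ⟨t, ht⟩ := hr.tree.exists_top
  have := hr.excess_pos t
  rw [excess_top ht] at this
  omega

lemma numPrimeLoad_zero_left (m : ℕ) : numPrimeLoad 0 m = 0 := by
  rw [numPrimeLoad, cardPrimeLoad, Nat.card_eq_zero]
  refine Or.inl ⟨fun ⟨r, hr⟩ => ?_⟩
  obtain ⟨t, ht⟩ := hr.tree.exists_top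
  rcases t with t | t
  · exact t.elim0
  · exact hr.not_top _ rfl ht

lemma numPrimeLoad_one_zero : numPrimeLoad 1 0 = 1 := by
  rw [numPrimeLoad, cardPrimeLoad, Nat.card_eq_one_iff_unique]
  have : Subsingleton (Fin 1 ⊕ Fin 0) := ⟨by simp⟩
  refine ⟨⟨fun r r' => ?_⟩, ⟨fun _ _ => True, ⟨by simp, fun a b _ _ => Subsingleton.elim _ _,
    by simp, by simp, ⟨Sum.inl 0, by simp⟩⟩, by simp, by simp, by simp⟩⟩
  ext a b
  rw [Subsingleton.elim a b]
  exact iff_of_true (r.2.tree.refl b) (r'.2.tree.refl b)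

lemma numPrimeLoad_zero_right {n : ℕ} (hn : n ≠ 1) : numPrimeLoad n 0 = 0 := by
  rcases Nat.eq_zero_or_pos n with rfl | hpos
  · exact numPrimeLoad_zero_left 0
  rw [numPrimeLoad, cardPrimeLoad, Nat.card_eq_zero]
  refine Or.inl ⟨fun ⟨r, hr⟩ => ?_⟩
  have key (u) (hu : ¬ ∀ a, r a u) : False := by
    have h1 := hr.excess_pos u hu
    have h2 : excess (fun a : Fin n ⊕ Fin 0 => a.isRight = true) r u ≤ 0 :=
      Finset.sum_nonpos fun a _ => by
        rcases a with a | a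
        · split_ifs <;> simp_all
        · exact a.elim0
    omega
  let a : Fin n := ⟨0, hpos⟩
  let b : Fin n := ⟨1, by omega⟩
  have ha : ∀ x, r x (Sum.inl a) := by_contra fun h => key _ h
  have hb : ∀ x, r x (Sum.inl b) := by_contra fun h => key _ h
  have := hr.tree.antisymm _ _ (hb (Sum.inl a)) (ha (Sum.inl b))
  simp [a, b] at this

lemma numOverloaded_zero_one : numOverloaded 0 1 = 1 := by
  rw [numOverloaded, cardOverloaded, Nat.card_eq_one_iff_unique]
  have : Subsingleton (Fin 0 ⊕ Fin 1) := ⟨by simp⟩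
  refine ⟨⟨fun r r' => ?_⟩, ⟨fun _ _ => True, ⟨by simp, fun a b _ _ => Subsingleton.elim _ _,
    by simp, by simp, ⟨Sum.inr 0, by simp⟩⟩, fun _ _ _ _ => Subsingleton.elim _ _, fun u => ?_⟩⟩
  · ext a b
    rw [Subsingleton.elim a b]
    exact iff_of_true (r.2.tree.refl b) (r'.2.tree.refl b)
  · simp [excess_top]

/-- The two conditions differ only at the root. Its excess `m - n` is positive anyway, and a driver,
being a leaf, can be the root only of a one-node tree. -/
lemma numOverloaded_of_lt {n m : ℕ} (h : n < m) (h' : ¬ (n = 0 ∧ m = 1)) :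
    numOverloaded n m = numPrimeLoad n m := by
  refine Nat.card_congr (Equiv.subtypeEquivRight fun r => ⟨fun hr => ?_, fun hr => ?_⟩)
  · refine ⟨hr.tree, hr.minimal, fun d hd hd' => h' ?_, fun u _ => hr.excess_pos u⟩
    have hcard : Fintype.card (Fin n ⊕ Fin m) ≤ 1 := Fintype.card_le_one_iff.2 fun a b => by
      rw [hr.minimal d hd a (hd' a), hr.minimal d hd b (hd' b)]
    simp only [Fintype.card_sum, Fintype.card_fin] at hcard
    omega
  · refine ⟨hr.tree, hr.minimal, fun u => ?_⟩
    by_cases hu : ∀ a, r a u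
    · rw [excess_top hu]
      omega
    · exact hr.excess_pos u hu

/-- The root spot contributes -1 and each branch at least 1, so only the lone spot has negative
excess. In the recurrence, removing a branch lowers the excess further, to at most -2, so the
exceptional case is never met. -/
lemma numPrimeLoad_eq_zero {n m : ℕ} (h : m < n) (h' : ¬ (n = 1 ∧ m = 0)) :
    numPrimeLoad n m = 0 := by
  induction m using Nat.strong_induction_on generalizing n with
  | _ m ih =>
    rcases Nat.eq_zero_or_pos m with rfl | hm
    · exact numPrimeLoad_zero_right (by omega)
    have := mul_numPrimeLoad n m
    rw [Finset.sum_eq_zero fun i hi => Finset.sum_eq_zero fun j hj => ?_] at this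
    · simpa [hm.ne'] using this
    · simp only [Finset.mem_range] at hi hj
      rcases Nat.lt_or_ge i j with hij | hij
      · rw [ih (m - j) (by omega) (by omega) (by omega)]
        simp
      · rw [numOverloaded_of_le hij]
        simp

/-! ### Exponential weights and derivations of power series in t and y -/

open PowerSeries

/-- The exponential weight of the class of prime loads. -/
noncomputable def primeWeight (n m : ℕ) : ℚ := numPrimeLoad n m / (n.factorial * m.factorial)

/-- The exponential weight of the class of overloaded trees. -/
noncomputable def overWeight (n m : ℕ) : ℚ := numOverloaded n m / (n.factorial * m.factorial)

lemma mul_primeWeight (n m : ℕ) : m * primeWeight n m =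
    ∑ p ∈ Finset.HasAntidiagonal.antidiagonal n, ∑ q ∈ Finset.HasAntidiagonal.antidiagonal m,
      q.1 * overWeight p.1 q.1 * primeWeight p.2 q.2 := by
  have h := congrArg (Nat.cast (R := ℚ)) (mul_numPrimeLoad n m)
  rw [Nat.cast_mul] at h
  rw [primeWeight, ← mul_div_assoc, h, Finset.Nat.sum_antidiagonal_eq_sum_range_succ_mk]
  push_cast
  rw [Finset.sum_div]
  refine Finset.sum_congr rfl fun i hi => ?_
  rw [Finset.Nat.sum_antidiagonal_eq_sum_range_succ_mk, Finset.sum_div]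
  refine Finset.sum_congr rfl fun j hj => ?_
  have hi' : i ≤ n := by simpa [Nat.lt_succ_iff] using hi
  have hj' : j ≤ m := by simpa [Nat.lt_succ_iff] using hj
  rw [Nat.cast_choose ℚ hi', Nat.cast_choose ℚ hj', overWeight, primeWeight]
  have := fun k : ℕ => (Nat.cast_ne_zero (R := ℚ)).2 k.factorial_ne_zero
  field_simp [this]

lemma overWeight_of_le {n m : ℕ} (h : m ≤ n) : overWeight n m = 0 := by
  simp [overWeight, numOverloaded_of_le h]

lemma overWeight_of_lt {n m : ℕ} (h : n < m) :
    overWeight n m = primeWeight n m + if n = 0 ∧ m = 1 then 1 else 0 := by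
  split_ifs with h'
  · obtain ⟨rfl, rfl⟩ := h'
    simp [overWeight, primeWeight, numOverloaded_zero_one, numPrimeLoad_zero_left]
  · rw [overWeight, numOverloaded_of_lt h h', primeWeight, add_zero]

lemma primeWeight_zero_left (m : ℕ) : primeWeight 0 m = 0 := by
  simp [primeWeight, numPrimeLoad_zero_left]

lemma primeWeight_one_zero : primeWeight 1 0 = 1 := by
  simp [primeWeight, numPrimeLoad_one_zero]

lemma primeWeight_eq_zero {n m : ℕ} (h : m < n) (h' : ¬ (n = 1 ∧ m = 0)) :
    primeWeight n m = 0 := by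
  simp [primeWeight, numPrimeLoad_eq_zero h h']

/-- The derivation multiplying the coefficient of `t ^ n * y ^ k` by `a * n + b * k`, where `t`
is the inner and `y` the outer variable. -/
noncomputable def eulerDeriv (a b : ℚ) (f : ℚ⟦X⟧⟦X⟧) : ℚ⟦X⟧⟦X⟧ :=
  mk fun k => mk fun n => (a * n + b * k) * coeff n (coeff k f)

@[simp] lemma coeff_eulerDeriv (a b : ℚ) (f : ℚ⟦X⟧⟦X⟧) (n k : ℕ) :
    coeff n (coeff k (eulerDeriv a b f)) = (a * n + b * k) * coeff n (coeff k f) := by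
  simp [eulerDeriv]

lemma coeff_coeff_mul (f g : ℚ⟦X⟧⟦X⟧) (n k : ℕ) : coeff n (coeff k (f * g)) =
    ∑ q ∈ Finset.HasAntidiagonal.antidiagonal k, ∑ p ∈ Finset.HasAntidiagonal.antidiagonal n,
      coeff p.1 (coeff q.1 f) * coeff p.2 (coeff q.2 g) := by
  simp [coeff_mul]

section EulerDeriv

variable (a b : ℚ) (f g : ℚ⟦X⟧⟦X⟧)

lemma eulerDeriv_add : eulerDeriv a b (f + g) = eulerDeriv a b f + eulerDeriv a b g := by
  ext k n
  simp [mul_add]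

lemma eulerDeriv_sub : eulerDeriv a b (f - g) = eulerDeriv a b f - eulerDeriv a b g := by
  ext k n
  simp [mul_sub]

lemma eulerDeriv_mul :
    eulerDeriv a b (f * g) = eulerDeriv a b f * g + f * eulerDeriv a b g := by
  ext k n
  rw [coeff_eulerDeriv, map_add, map_add, coeff_coeff_mul, coeff_coeff_mul, coeff_coeff_mul,
    Finset.mul_sum, ← Finset.sum_add_distrib]
  refine Finset.sum_congr rfl fun q hq => ?_
  rw [Finset.mul_sum, ← Finset.sum_add_distrib]
  refine Finset.sum_congr rfl fun p hp => ?_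
  rw [Finset.HasAntidiagonal.mem_antidiagonal] at hq hp
  rw [coeff_eulerDeriv, coeff_eulerDeriv, ← hq, ← hp]
  push_cast
  ring

lemma eulerDeriv_comm (a' b' : ℚ) :
    eulerDeriv a b (eulerDeriv a' b' f) = eulerDeriv a' b' (eulerDeriv a b f) := by
  ext k n
  simp only [coeff_eulerDeriv]
  ring

lemma eulerDeriv_X : eulerDeriv a b (X : ℚ⟦X⟧⟦X⟧) = C (C b) * X := by
  ext k n
  rw [coeff_eulerDeriv, coeff_C_mul, coeff_C_mul, coeff_X]
  split_ifs with hk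
  · rw [coeff_one]
    split_ifs with hn <;> simp [hk, hn]
  · simp

lemma eulerDeriv_C (f : ℚ⟦X⟧) :
    eulerDeriv a b (C f) = C (mk fun n => a * n * coeff n f) := by
  ext k n
  rw [coeff_eulerDeriv, coeff_C, coeff_C]
  split_ifs with hk <;> simp [hk]

lemma eulerDeriv_C_X : eulerDeriv a b (C (X : ℚ⟦X⟧)) = C (C a * X) := by
  rw [eulerDeriv_C]
  congr 1
  ext n
  rw [coeff_mk, coeff_C_mul, coeff_X]
  split_ifs with hn <;> simp [hn]

end EulerDeriv

/-- A solution of the homogeneous linear equation satisfied by the derivatives of `loadSeries`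
vanishes as soon as its linear part does. -/
lemma eq_zero_of_eulerDeriv {B Z : ℚ⟦X⟧⟦X⟧}
    (hZ : eulerDeriv 1 1 Z = Z + Z * eulerDeriv 1 1 B)
    (h10 : coeff 1 (coeff 0 Z) = 0) (h01 : coeff 0 (coeff 1 Z) = 0) : Z = 0 := by
  suffices h : ∀ d n k, n + k = d → coeff n (coeff k Z) = 0 by
    ext k n
    simpa using h _ n k rfl
  intro d
  induction d using Nat.strong_induction_on with
  | _ d ih =>
    intro n k hd
    have h := congrArg (fun f => coeff n (coeff k f)) hZ
    simp only [coeff_eulerDeriv, map_add] at h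
    -- Terms of lower degree in `Z` vanish by induction, and the term of full degree meets the
    -- constant coefficient of `eulerDeriv 1 1 B`, which is 0. What remains is (n + k - 1) times the
    -- coefficient of `Z`.
    have h0 : coeff n (coeff k (Z * eulerDeriv 1 1 B)) = 0 := by
      rw [coeff_coeff_mul]
      refine Finset.sum_eq_zero fun q hq => Finset.sum_eq_zero fun p hp => ?_
      rw [Finset.HasAntidiagonal.mem_antidiagonal] at hq hp
      by_cases hpq : p.2 = 0 ∧ q.2 = 0
      · rw [hpq.1, hpq.2, coeff_eulerDeriv]
        simp
      · rw [ih (p.1 + q.1) (by omega) _ _ rfl, zero_mul]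
    rw [h0, add_zero] at h
    by_cases h1 : n + k = 1
    · have : (n = 1 ∧ k = 0) ∨ (n = 0 ∧ k = 1) := by omega
      rcases this with ⟨rfl, rfl⟩ | ⟨rfl, rfl⟩
      · exact h10
      · exact h01
    · have h2 : ((n : ℚ) + k - 1) * coeff n (coeff k Z) = 0 := by linarith
      refine (mul_eq_zero.1 h2).resolve_left fun h3 => h1 ?_
      have : ((n + k : ℕ) : ℚ) = 1 := by push_cast; linarith
      exact_mod_cast this

/-! ### The series of prime loads and overloaded trees -/

/-- The generating function of overloaded trees; `t` marks spots and `y` marks excess. -/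
noncomputable def overSeries : ℚ⟦X⟧⟦X⟧ := mk fun k => mk fun n => overWeight n (n + k)

/-- The generating function of prime loads, multiplied by `y`; `t` marks spots and `y` marks
excess. -/
noncomputable def loadSeries : ℚ⟦X⟧⟦X⟧ := mk fun k => mk fun n => primeWeight n (n + k - 1)

/-- The generating function of prime loads with equally many spots and drivers. -/
noncomputable def balancedSeries : ℚ⟦X⟧ := mk fun n => primeWeight n n

lemma coeff_loadSeries (n k : ℕ) :
    coeff n (coeff k loadSeries) = primeWeight n (n + k - 1) := by
  simp [loadSeries]

lemma coeff_overSeries (n k : ℕ) : coeff n (coeff k overSeries) = overWeight n (n + k) := by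
  simp [overSeries]

/-- The total degree of a monomial is the number m of drivers in `overSeries` and m + 1 in
`loadSeries`, so this is `mul_primeWeight`; the extra 1 yields the summand `loadSeries`. -/
lemma eulerDeriv_loadSeries :
    eulerDeriv 1 1 loadSeries = loadSeries + loadSeries * eulerDeriv 1 1 overSeries := by
  ext k n
  simp only [coeff_eulerDeriv, map_add, one_mul, coeff_loadSeries]
  rw [mul_comm loadSeries, coeff_coeff_mul]
  simp only [coeff_eulerDeriv, one_mul, coeff_loadSeries, coeff_overSeries]
  rcases Nat.eq_zero_or_pos (n + k) with h | h
  · obtain ⟨rfl, rfl⟩ : n = 0 ∧ k = 0 := by omega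
    simp [primeWeight_zero_left]
  have hrec := mul_primeWeight n (n + k - 1)
  have hcast : ((n + k - 1 : ℕ) : ℚ) = n + k - 1 := by
    rw [Nat.cast_sub h]
    push_cast
    ring
  rw [hcast] at hrec
  have : ((n : ℚ) + k) * primeWeight n (n + k - 1) = primeWeight n (n + k - 1) +
    ∑ p ∈ Finset.HasAntidiagonal.antidiagonal n, ∑ q ∈ Finset.HasAntidiagonal.antidiagonal (n + k - 1),
      q.1 * overWeight p.1 q.1 * primeWeight p.2 q.2 := by linarith
  rw [this, Finset.sum_comm (s := Finset.HasAntidiagonal.antidiagonal k)]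
  congr 1
  refine Finset.sum_congr rfl fun p hp => ?_
  rw [Finset.HasAntidiagonal.mem_antidiagonal] at hp
  -- The case `p.2 = 0` is set apart since `p.2 + q.2 - 1` below could truncate.
  rcases Nat.eq_zero_or_pos p.2 with hp0 | hp0
  · simp [hp0, primeWeight_zero_left]
  symm
  -- From exponents of y to numbers of drivers, in the branch and in the rest. The pairs missed have
  -- a branch of negative excess or a rest of excess below -1, hence weight 0.
  refine Finset.sum_of_injOn (fun q => (p.1 + q.1, p.2 + q.2 - 1)) ?_ ?_ ?_ ?_
  · rintro ⟨a, b⟩ hab ⟨c, d⟩ hcd hq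
    simp only [Prod.mk.injEq, Finset.mem_coe,
      Finset.HasAntidiagonal.mem_antidiagonal] at *
    omega
  · rintro ⟨a, b⟩ hab
    simp only [Finset.mem_coe,
      Finset.HasAntidiagonal.mem_antidiagonal] at *
    omega
  · rintro ⟨a, b⟩ hab hnot
    rw [Finset.HasAntidiagonal.mem_antidiagonal] at hab
    dsimp only at hab ⊢
    rcases le_or_gt a p.1 with ha | ha
    · rw [overWeight_of_le ha]
      simp
    · rw [primeWeight_eq_zero (n := p.2) (m := b), mul_zero]
      all_goals
        by_contra hb
        refine hnot ⟨(a - p.1, b + 1 - p.2), ?_, ?_⟩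
        · simp only [Finset.mem_coe, Finset.HasAntidiagonal.mem_antidiagonal]
          omega
        · simp only [Prod.mk.injEq]
          omega
  · rintro ⟨a, b⟩ -
    push_cast
    ring

lemma coeff_zero_coeff_loadSeries (k : ℕ) : coeff 0 (coeff k loadSeries) = 0 := by
  rw [coeff_loadSeries, primeWeight_zero_left]

lemma coeff_zero_coeff_zero_overSeries : coeff 0 (coeff 0 overSeries) = 0 := by
  rw [coeff_overSeries, overWeight_of_le (by simp)]

/-- The derivations commute, so the difference Z of the two sides inherits DZ = Z + Z·DB from the
equation for `loadSeries`, and its linear coefficients vanish. This recovers both partial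
derivatives of F = t exp(B) without exponentials. -/
lemma loadSeries_logDeriv_y :
    eulerDeriv 0 1 loadSeries = loadSeries * eulerDeriv 0 1 overSeries := by
  rw [← sub_eq_zero]
  refine eq_zero_of_eulerDeriv (B := overSeries) ?_ ?_ ?_
  · rw [eulerDeriv_sub, eulerDeriv_comm, eulerDeriv_mul, eulerDeriv_loadSeries, eulerDeriv_add,
      eulerDeriv_mul, eulerDeriv_comm 1 1 overSeries]
    ring
  · simp [-coeff_zero_eq_constantCoeff, coeff_coeff_mul, Finset.Nat.antidiagonal_succ, coeff_zero_coeff_zero_overSeries]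
  · simp [-coeff_zero_eq_constantCoeff, coeff_coeff_mul, Finset.Nat.antidiagonal_succ, coeff_zero_coeff_loadSeries]

lemma loadSeries_logDeriv_t : eulerDeriv 1 0 loadSeries =
    loadSeries + loadSeries * eulerDeriv 1 0 overSeries := by
  have key (f : ℚ⟦X⟧⟦X⟧) : eulerDeriv 1 0 f = eulerDeriv 1 1 f - eulerDeriv 0 1 f := by
    ext k n
    simp only [coeff_eulerDeriv, map_sub]
    ring
  rw [key, key, eulerDeriv_loadSeries, loadSeries_logDeriv_y]
  ring

/-- The coefficient of y^0 is the lone spot, of excess -1; that of y^1 is the balanced part; from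
y^2 on, prime loads are overloaded trees, apart from the lone driver, which the term `- X` removes.
-/
lemma loadSeries_eq :
    loadSeries = C X + X * (overSeries + C balancedSeries - X) := by
  ext k n
  rcases k with _ | k
  · rw [coeff_loadSeries, map_add, coeff_zero_X_mul, coeff_zero_C, add_zero, add_zero, coeff_X]
    split_ifs with hn
    · rw [hn]
      exact primeWeight_one_zero
    · rcases Nat.eq_zero_or_pos n with rfl | hpos
      · exact primeWeight_zero_left _
      · exact primeWeight_eq_zero (by omega) (by omega)
  · rw [coeff_loadSeries, map_add, coeff_succ_X_mul, coeff_succ_C, zero_add, map_sub, map_add,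
      map_sub, map_add, coeff_overSeries]
    rw [← Nat.add_assoc, Nat.add_sub_cancel]
    rcases k with _ | k
    · rw [coeff_zero_C, coeff_zero_X, overWeight_of_le (by simp)]
      simp [balancedSeries]
    · rw [overWeight_of_lt (by omega), coeff_succ_C, coeff_X]
      rcases k with _ | k
      · rw [if_pos rfl, coeff_one]
        simp
      · simp
        omega

/-! ### The kernel method modulo F - y -/

lemma X_dvd_coeff_loadSeries (k : ℕ) : X ∣ coeff k loadSeries := by
  rw [X_dvd_iff, ← coeff_zero_eq_constantCoeff_apply, coeff_zero_coeff_loadSeries]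

/-- At y = 0 the series F - y becomes t, which is not a zero divisor, so the cofactor is divisible
by y and y cancels. -/
lemma dvd_of_dvd_X_mul {h : ℚ⟦X⟧⟦X⟧} (hd : loadSeries - X ∣ X * h) : loadSeries - X ∣ h := by
  obtain ⟨q, hq⟩ := hd
  have h0 : constantCoeff loadSeries = (X : ℚ⟦X⟧) := by
    rw [loadSeries_eq]
    simp
  have h1 := congrArg constantCoeff hq
  rw [map_mul, map_mul, map_sub, h0, constantCoeff_X, zero_mul, sub_zero] at h1
  obtain ⟨q', rfl⟩ := X_dvd_iff.2 ((mul_eq_zero.1 h1.symm).resolve_left X_ne_zero)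
  refine ⟨q', mul_left_cancel₀ X_ne_zero (hq.trans ?_)⟩
  ring

/-- This replaces substituting a root y = Y(t) of F = y. Comparing positive powers of y, the
cofactor `q` satisfies q_k = (Fq)_{k+1}; as t divides F, every power of t divides `q`. -/
lemma eq_zero_of_dvd_C {f : ℚ⟦X⟧} (hd : loadSeries - X ∣ C f) : f = 0 := by
  obtain ⟨q, hq⟩ := hd
  have h1 (k : ℕ) : coeff k q = coeff (k + 1) (loadSeries * q) := by
    have h := congrArg (coeff (k + 1)) hq
    rw [coeff_succ_C, sub_mul, map_sub, coeff_succ_X_mul] at h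
    exact (sub_eq_zero.1 h.symm).symm
  have h2 (r : ℕ) : ∀ k, X ^ r ∣ coeff k q := by
    induction r with
    | zero => simp
    | succ r ih =>
      intro k
      rw [h1, coeff_mul]
      refine Finset.dvd_sum fun p _ => ?_
      rw [pow_succ']
      exact mul_dvd_mul (X_dvd_coeff_loadSeries _) (ih _)
  have h3 : q = 0 := by
    ext k n
    simpa using X_pow_dvd_iff.1 (h2 (n + 1) k) n (Nat.lt_succ_self n)
  rw [h3, mul_zero] at hq
  simpa using congrArg constantCoeff hq

lemma balancedSeries_eq : (mk fun n => n * coeff n balancedSeries : ℚ⟦X⟧) =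
    X * catalanSeries.map (Nat.castRingHom ℚ) := by
  set g : ℚ⟦X⟧ := mk fun n => n * coeff n balancedSeries with hg
  have hP : eulerDeriv 1 0 (C balancedSeries) = C g := by
    rw [eulerDeriv_C, hg]
    simp
  have hy := loadSeries_logDeriv_y
  have ht := loadSeries_logDeriv_t
  have hF := loadSeries_eq
  have hy' := congrArg (eulerDeriv 0 1) hF
  have ht' := congrArg (eulerDeriv 1 0) hF
  simp only [eulerDeriv_add, eulerDeriv_sub, eulerDeriv_mul, eulerDeriv_C_X, eulerDeriv_X, hP,
    map_zero, map_one, zero_mul, one_mul, zero_add] at hy' ht'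
  have hP' : eulerDeriv 0 1 (C balancedSeries) = 0 := by
    rw [eulerDeriv_C, ← map_zero C]
    congr 1
    ext n
    simp
  rw [hP'] at hy'
  set F := loadSeries
  set B := overSeries
  set P : ℚ⟦X⟧⟦X⟧ := C balancedSeries
  set t : ℚ⟦X⟧⟦X⟧ := C X
  have d1 : F - X ∣ 2 * X - B - P := by
    refine dvd_of_dvd_X_mul ⟨-eulerDeriv 0 1 B, ?_⟩
    linear_combination hy' - hy
  have d2 : F - X ∣ X - t - X * X := by
    obtain ⟨q, hq⟩ := d1
    refine ⟨-1 - X * q, ?_⟩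
    linear_combination hF - X * hq
  have d3 : F - X ∣ X - t - X * C g := by
    refine ⟨-1 - eulerDeriv 1 0 B, ?_⟩
    linear_combination ht' - ht
  have d4 : F - X ∣ X - C g := by
    refine dvd_of_dvd_X_mul ?_
    convert dvd_sub d3 d2 using 1
    ring
  have h1 : g - X - g * g = 0 := by
    refine eq_zero_of_dvd_C ?_
    convert dvd_sub d2 (d4.mul_right (1 - X - C g)) using 1
    simp only [map_sub, map_mul, t]
    ring
  set c : ℚ⟦X⟧ := catalanSeries.map (Nat.castRingHom ℚ)
  have h2 : c ^ 2 * X + 1 = c := by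
    simpa using congrArg (PowerSeries.map (Nat.castRingHom ℚ)) catalanSeries_sq_mul_X_add_one
  -- Both `g` and `X * c` solve z = t + z². The second factor has constant term 1, so it is the
  -- first that vanishes.
  have h3 : (g - X * c) * (1 - g - X * c) = 0 := by
    linear_combination h1 + X * h2
  refine sub_eq_zero.1 ((mul_eq_zero.1 h3).resolve_right fun h => ?_)
  have h4 := congrArg constantCoeff h
  have h5 : constantCoeff g = 0 := by
    rw [← coeff_zero_eq_constantCoeff_apply, hg]
    simp
  simp [h5] at h4

theorem numPrimeLoad_self (n : ℕ) (hn : 1 ≤ n) : numPrimeLoad n n = (2 * n - 2).factorial := by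
  obtain ⟨k, rfl⟩ := Nat.exists_eq_add_of_le' hn
  have h := congrArg (coeff (k + 1)) balancedSeries_eq
  rw [coeff_succ_X_mul, coeff_mk, balancedSeries, coeff_mk, coeff_map, catalanSeries_coeff,
    primeWeight] at h
  have h1 : ((k : ℚ) + 1) * catalan k = k.centralBinom := by
    exact_mod_cast succ_mul_catalan_eq_centralBinom k
  have h2 : (k.centralBinom : ℚ) * k.factorial * k.factorial = (2 * k).factorial := by
    have := Nat.choose_mul_factorial_mul_factorial (show k ≤ 2 * k by omega)
    rw [show 2 * k - k = k by omega] at this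
    exact_mod_cast this
  have h3 : 2 * (k + 1) - 2 = 2 * k := by omega
  rw [h3]
  have h4 : (k.factorial : ℚ) ≠ 0 := by exact_mod_cast k.factorial_ne_zero
  have h5 : (k : ℚ) + 1 ≠ 0 := by positivity
  rw [Nat.factorial_succ] at h
  push_cast at h
  field_simp at h
  have h6 : (numPrimeLoad (k + 1) (k + 1) : ℚ) = (2 * k).factorial := by
    rw [← h2, ← h1]
    linear_combination h
  exact_mod_cast h6

/-! ### Parking on a tree and the edge criterion -/

namespace LabeledRootedTree

variable {n : ℕ} {T : LabeledRootedTree n}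

lemma below_refl (v : Fin n) : T.Below v v := ⟨0, rfl⟩

lemma Below.trans {u v w : Fin n} (h : T.Below u v) (h' : T.Below v w) : T.Below u w := by
  obtain ⟨k, rfl⟩ := h
  obtain ⟨l, rfl⟩ := h'
  exact ⟨l + k, Function.iterate_add_apply _ _ _ _⟩

lemma iterate_parent_root (k : ℕ) : T.parent^[k] T.root = T.root :=
  Function.iterate_fixed T.parent_root k

/-- A vertex on a cycle is the root: going round often enough passes the root, which is a fixed
point. -/
lemma Below.antisymm {v w : Fin n} (h : T.Below v w) (h' : T.Below w v) : v = w := by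
  obtain ⟨a, rfl⟩ := h
  obtain ⟨b, hb⟩ := h'
  rw [← Function.iterate_add_apply] at hb
  rcases Nat.eq_zero_or_pos (b + a) with h0 | h0
  · obtain rfl : a = 0 := by omega
    rfl
  obtain ⟨k, hk⟩ := T.reaches_root v
  have h1 : T.parent^[(b + a) * k] v = v := by
    rw [Function.iterate_mul]
    exact Function.iterate_fixed hb k
  have h2 : v = T.root := by
    have h3 : k ≤ (b + a) * k := Nat.le_mul_of_pos_left k h0
    rw [← h1, ← Nat.sub_add_cancel h3, Function.iterate_add_apply, hk, iterate_parent_root]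
  rw [h2, iterate_parent_root]

lemma below_iterate_of_le {v : Fin n} {a b : ℕ} (h : a ≤ b) :
    T.Below (T.parent^[a] v) (T.parent^[b] v) :=
  ⟨b - a, by rw [← Function.iterate_add_apply, Nat.sub_add_cancel h]⟩

lemma Below.chain {u v w : Fin n} (h : T.Below u v) (h' : T.Below u w) :
    T.Below v w ∨ T.Below w v := by
  obtain ⟨a, rfl⟩ := h
  obtain ⟨b, rfl⟩ := h'
  exact (le_total a b).imp below_iterate_of_le below_iterate_of_le

lemma parent_ne {v : Fin n} (h : v ≠ T.root) : T.parent v ≠ v := by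
  intro hv
  obtain ⟨k, hk⟩ := T.reaches_root v
  exact h ((Function.iterate_fixed hv k).symm.trans hk)

lemma Below.parent {v w : Fin n} (h : T.Below v w) (hne : v ≠ w) : T.Below (T.parent v) w := by
  obtain ⟨_ | k, rfl⟩ := h
  · exact (hne rfl).elim
  · exact ⟨k, rfl⟩

lemma firstFree_eq_some {occ : Finset (Fin n)} {v w : Fin n} (h : T.firstFree occ v = some w) :
    ∃ k, T.parent^[k] v = w ∧ w ∉ occ ∧ ∀ j < k, T.parent^[j] v ∈ occ := by
  classical
  rw [firstFree] at h
  split_ifs at h with hex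
  rw [Option.some.injEq] at h
  subst h
  exact ⟨_, rfl, Nat.find_spec hex, fun j hj => not_not.1 (Nat.find_min hex hj)⟩

lemma exists_firstFree {occ : Finset (Fin n)} {v : Fin n} {k : ℕ}
    (h : T.parent^[k] v ∉ occ) : ∃ w, T.firstFree occ v = some w ∧ T.Below w (T.parent^[k] v) := by
  classical
  have hex : ∃ k, T.parent^[k] v ∉ occ := ⟨k, h⟩
  exact ⟨_, dif_pos hex, below_iterate_of_le (Nat.find_min' hex h)⟩

variable {s : Fin n → Fin n}

lemma occupied_succ (i : Fin n) :
    T.occupied s (i + 1) = match T.parkingSpot s i with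
      | some w => insert w (T.occupied s i)
      | none => T.occupied s i := by
  rw [occupied, dif_pos i.2]
  rfl

lemma mem_occupied {m : ℕ} {w : Fin n} :
    w ∈ T.occupied s m ↔ ∃ i : Fin n, i.1 < m ∧ T.parkingSpot s i = some w := by
  induction m with
  | zero => simp [occupied]
  | succ m ih =>
    by_cases hm : m < n
    · have h := occupied_succ (T := T) (s := s) ⟨m, hm⟩
      have h' : (∃ i : Fin n, i.1 < m + 1 ∧ T.parkingSpot s i = some w) ↔
          T.parkingSpot s ⟨m, hm⟩ = some w ∨ w ∈ T.occupied s m := by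
        rw [ih]
        constructor
        · rintro ⟨i, hi, hw⟩
          rcases Nat.lt_succ_iff_lt_or_eq.1 hi with hi | hi
          · exact Or.inr ⟨i, hi, hw⟩
          · obtain rfl : i = ⟨m, hm⟩ := Fin.ext hi
            exact Or.inl hw
        · rintro (hw | ⟨i, hi, hw⟩)
          · exact ⟨_, Nat.lt_succ_self m, hw⟩
          · exact ⟨i, Nat.lt_succ_of_lt hi, hw⟩
      rw [h, h']
      cases T.parkingSpot s ⟨m, hm⟩ with
      | none => simp
      | some x => simp [eq_comm]
    · rw [occupied, dif_neg hm, ih]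
      exact exists_congr fun i => and_congr_left fun _ => by omega

lemma parkingSpot_injective {i j : Fin n} {w : Fin n} (hi : T.parkingSpot s i = some w)
    (hj : T.parkingSpot s j = some w) : i = j := by
  have key {a b : Fin n} (ha : T.parkingSpot s a = some w) (hb : T.parkingSpot s b = some w) :
      ¬ a < b := fun hab => by
    obtain ⟨-, -, h, -⟩ := firstFree_eq_some hb
    exact h (mem_occupied.2 ⟨a, hab, ha⟩)
  exact le_antisymm (not_lt.1 (key hj hi)) (not_lt.1 (key hi hj))

/-- If `v` stayed empty, all drivers preferring `T_v` would park at distinct spots of `T_v` other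
than `v`, too few for them. So every spot is filled, and with `n` drivers everybody parks. -/
lemma isParkingFunction_of_ncard_le
    (h : ∀ v, (T.subtree v).ncard ≤ {i : Fin n | s i ∈ T.subtree v}.ncard) :
    T.IsParkingFunction s := by
  have hocc (v : Fin n) : ∃ i, T.parkingSpot s i = some v := by
    by_contra! hv
    have hspot (i : Fin n) (hi : s i ∈ T.subtree v) :
        ∃ w, T.parkingSpot s i = some w ∧ w ∈ T.subtree v \ {v} := by
      obtain ⟨k, hk⟩ := hi
      have hfree : T.parent^[k] (s i) ∉ T.occupied s i := by
        rw [hk, mem_occupied]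
        exact fun ⟨j, _, hj⟩ => hv j hj
      obtain ⟨w, hw, hwv⟩ := exists_firstFree hfree
      rw [hk] at hwv
      exact ⟨w, hw, hwv, fun hwv' => hv i (hwv' ▸ hw)⟩
    choose! f hf hf' using hspot
    have hle : {i : Fin n | s i ∈ T.subtree v}.ncard ≤ (T.subtree v \ {v}).ncard :=
      Set.ncard_le_ncard_of_injOn f hf' fun i hi j hj hij =>
        parkingSpot_injective (hf i hi) (hij ▸ hf j hj)
    have hlt := Set.ncard_sdiff_singleton_lt_of_mem (s := T.subtree v) (below_refl v)
      (Set.toFinite _)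
    exact absurd (h v) (hle.trans_lt hlt).not_ge
  choose f hf using hocc
  have hinj : Function.Injective f := fun v w hvw => by
    have := hf v
    rw [hvw, hf w] at this
    exact (Option.some.inj this).symm
  intro i
  obtain ⟨v, rfl⟩ := (Finite.injective_iff_surjective.1 hinj) i
  exact ⟨v, hf v⟩

/-- Parking is a bijection, so exactly |T_u| drivers end in `T_u`, and they all preferred it. The
inequality is strict iff some driver starts in `T_u` and parks outside, which forces her across the
edge at `u`. -/
theorem IsParkingFunction.ncard_subtree_lt_iff (hs : T.IsParkingFunction s) {u : Fin n}
    (hu : u ≠ T.root) :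
    (T.subtree u).ncard < {i : Fin n | s i ∈ T.subtree u}.ncard ↔ T.EdgeUsed s u := by
  choose p hp using hs
  have hinj : Function.Injective p := fun i j hij =>
    parkingSpot_injective (hp i) (hij ▸ hp j)
  have hcard : {i | p i ∈ T.subtree u}.ncard = (T.subtree u).ncard :=
    Set.ncard_preimage_of_injective_subset_range hinj
      (by rw [(Finite.injective_iff_surjective.1 hinj).range_eq]; exact Set.subset_univ _)
  have hsub : {i | p i ∈ T.subtree u} ⊆ {i | s i ∈ T.subtree u} := fun i hi => by
    obtain ⟨k, hk, -⟩ := firstFree_eq_some (hp i)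
    exact Below.trans ⟨k, hk⟩ hi
  rw [← hcard]
  constructor
  · intro hlt
    obtain ⟨i, hi, hi'⟩ := Set.exists_mem_notMem_of_ncard_lt_ncard hlt
    obtain ⟨k, hk⟩ := hi
    obtain ⟨m, hm, -, hocc⟩ := firstFree_eq_some (hp i)
    refine ⟨hu, i, k, hk, fun j hj => hocc j ?_⟩
    by_contra hmj
    refine hi' ?_
    change T.Below (p i) u
    rw [← hm, ← hk]
    exact below_iterate_of_le (by omega)
  · rintro ⟨-, i, k, hk, hocc⟩
    refine Set.ncard_lt_ncard (hsub.ssubset_of_mem_notMem (a := i) ⟨k, hk⟩ fun hi => ?_)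
    obtain ⟨m, hm, hfree, -⟩ := firstFree_eq_some (hp i)
    have hkm : k < m := by
      by_contra hmk
      exact hfree (hm ▸ hocc m (by omega))
    have hbelow : T.Below u (p i) := by
      rw [← hk, ← hm]
      exact below_iterate_of_le hkm.le
    rw [hbelow.antisymm hi] at hk
    exact hfree (hk ▸ hocc k le_rfl)

theorem IsParkingFunction.isPrimeParkingFunction_iff (hs : T.IsParkingFunction s) :
    T.IsPrimeParkingFunction s ↔ ∀ u, u ≠ T.root → T.EdgeUsed s u :=
  (and_iff_right hs).trans (forall₂_congr fun _ hu => hs.ncard_subtree_lt_iff hu)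

/-! ### Prime parking functions as prime loads -/

/-- The tree order on spots and drivers, where a driver is a leaf attached to her preferred
spot. -/
def loadOrder (T : LabeledRootedTree n) (s : Fin n → Fin n) :
    Fin n ⊕ Fin n → Fin n ⊕ Fin n → Prop
  | Sum.inl a, Sum.inl b => T.Below a b
  | Sum.inr d, Sum.inl b => T.Below (s d) b
  | Sum.inl _, Sum.inr _ => False
  | Sum.inr d, Sum.inr e => d = e

lemma isTreeOrder_loadOrder (T : LabeledRootedTree n) (s : Fin n → Fin n) :
    IsTreeOrder (T.loadOrder s) where
  refl := by
    rintro (a | a)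
    exacts [below_refl a, rfl]
  antisymm := by
    rintro (a | a) (b | b) h h'
    exacts [congrArg _ (h.antisymm h'), h.elim, h'.elim, congrArg _ h]
  trans := by
    rintro (a | a) (b | b) (c | c) h h'
    exacts [h.trans h', h'.elim, h.elim, h, h.trans h', h'.elim, by obtain rfl := h; exact h',
      h.trans h']
  chain := by
    rintro (a | a) (b | b) (c | c) h h'
    · exact h.chain h'
    · exact h'.elim
    · exact h.elim
    · exact h.elim
    · exact h.chain h'
    · obtain rfl := h'
      exact Or.inr h
    · obtain rfl := h
      exact Or.inl h'
    · exact Or.inl (h.symm.trans h')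
  exists_top := by
    refine ⟨Sum.inl T.root, ?_⟩
    rintro (a | a)
    exacts [T.reaches_root a, T.reaches_root (s a)]

lemma loadOrder_top_iff (u : Fin n ⊕ Fin n) :
    (∀ a, T.loadOrder s a u) ↔ u = Sum.inl T.root := by
  have htop : ∀ a, T.loadOrder s a (Sum.inl T.root) := by
    rintro (a | a)
    exacts [T.reaches_root a, T.reaches_root (s a)]
  refine ⟨fun h => (isTreeOrder_loadOrder T s).antisymm _ _ (htop u) (h _), ?_⟩
  rintro rfl
  exact htop

lemma excess_loadOrder_inl (v : Fin n) :
    excess (fun a => a.isRight = true) (T.loadOrder s) (Sum.inl v) =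
      {i : Fin n | s i ∈ T.subtree v}.ncard - (T.subtree v).ncard := by
  classical
  have hcard (p : Fin n → Prop) : {i | p i}.ncard = (Finset.univ.filter p).card := by
    rw [← Set.ncard_coe_finset]
    simp
  rw [excess, Fintype.sum_sum_type, subtree, hcard, hcard]
  simp [loadOrder, Finset.sum_ite]
  ring

lemma excess_loadOrder_inr (d : Fin n) :
    excess (fun a => a.isRight = true) (T.loadOrder s) (Sum.inr d) = 1 := by
  classical
  rw [excess, Fintype.sum_sum_type]
  simp [loadOrder]

/-- Driver nodes always have excess 1, and the condition that all drivers park is implied: at the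
root both counts are `n`. -/
lemma isPrimeParkingFunction_iff_isPrimeLoad : T.IsPrimeParkingFunction s ↔
    IsPrimeLoad (fun a => a.isRight = true) (T.loadOrder s) := by
  have hex (v : Fin n) : 1 ≤ excess (fun a => a.isRight = true) (T.loadOrder s) (Sum.inl v) ↔
      (T.subtree v).ncard < {i : Fin n | s i ∈ T.subtree v}.ncard := by
    rw [excess_loadOrder_inl]
    omega
  constructor
  · intro h
    refine ⟨isTreeOrder_loadOrder T s, ?_, ?_, ?_⟩
    · rintro (d | d) hd (a | a) h
      · simp at hd
      · simp at hd
      · exact h.elim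
      · exact congrArg _ h
    · rintro d hd h
      rw [(loadOrder_top_iff d).1 h] at hd
      simp at hd
    · rintro (v | d) hv
      · rw [loadOrder_top_iff] at hv
        exact (hex v).2 (h.2 v fun h => hv (congrArg _ h))
      · rw [excess_loadOrder_inr]
  · intro h
    have hlt : ∀ v, v ≠ T.root →
        (T.subtree v).ncard < {i : Fin n | s i ∈ T.subtree v}.ncard := fun v hv =>
      (hex v).1 (h.excess_pos _ fun h' => hv (Sum.inl.inj ((loadOrder_top_iff _).1 h')))
    refine ⟨isParkingFunction_of_ncard_le fun v => ?_, hlt⟩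
    rcases eq_or_ne v T.root with rfl | hv
    · have : T.subtree T.root = Set.univ := Set.eq_univ_of_forall T.reaches_root
      simp [this]
    · exact (hlt v hv).le

/-- The parent of a spot is its least strict ancestor and the preferred spot of a driver is the
least spot above her, so the order determines both. -/
lemma loadOrder_injective {T T' : LabeledRootedTree n} {s s' : Fin n → Fin n}
    (h : T.loadOrder s = T'.loadOrder s') : T = T' ∧ s = s' := by
  have hb (a b : Fin n) : T.Below a b ↔ T'.Below a b :=
    iff_of_eq (congrFun (congrFun h (Sum.inl a)) (Sum.inl b))
  have hd (d b : Fin n) : T.Below (s d) b ↔ T'.Below (s' d) b :=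
    iff_of_eq (congrFun (congrFun h (Sum.inr d)) (Sum.inl b))
  have hroot : T.root = T'.root :=
    Below.antisymm ((hb _ _).2 (T'.reaches_root _)) (T.reaches_root _)
  have hparent : T.parent = T'.parent := by
    funext v
    rcases eq_or_ne v T.root with rfl | hv
    · rw [T.parent_root, hroot, T'.parent_root]
    · have hv' : v ≠ T'.root := hroot ▸ hv
      refine Below.antisymm (T := T) (Below.parent ((hb _ _).2 ⟨1, rfl⟩) (parent_ne hv').symm)
        ((hb _ _).2 (Below.parent ((hb _ _).1 ⟨1, rfl⟩) (parent_ne hv).symm))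
  refine ⟨?_, funext fun d => Below.antisymm ((hd _ _).2 (below_refl _))
    ((hb _ _).2 ((hd _ _).1 (below_refl _)))⟩
  cases T
  cases T'
  cases hroot
  cases hparent
  rfl

end LabeledRootedTree

lemma IsTreeOrder.exists_cover {N : Type*} [Finite N] {r : N → N → Prop} (hr : IsTreeOrder r)
    {x : N} (hx : ¬ ∀ a, r a x) : ∃ y, r x y ∧ y ≠ x ∧ ∀ z, r x z → z ≠ x → r y z := by
  classical
  have := Fintype.ofFinite N
  obtain ⟨t, ht⟩ := hr.exists_top
  obtain ⟨y, hy, hmax⟩ := (Finset.univ.filter fun z => r x z ∧ z ≠ x).exists_max_image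
    (fun z => (Finset.univ.filter fun a => r z a).card)
    ⟨t, by simpa using ⟨ht x, fun h => hx (h ▸ ht)⟩⟩
  simp only [Finset.mem_filter, Finset.mem_univ, true_and] at hy hmax
  refine ⟨y, hy.1, hy.2, fun z hz hzx => (hr.chain _ _ _ hy.1 hz).elim id fun h => ?_⟩
  have hsub : (Finset.univ.filter fun a => r y a) ⊆ Finset.univ.filter fun a => r z a :=
    fun a => by simpa using hr.trans _ _ _ h
  have hz' : z ∈ Finset.univ.filter fun a => r z a := by simpa using hr.refl z
  rw [← Finset.eq_of_subset_of_card_le hsub (hmax z ⟨hz, hzx⟩)] at hz'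
  simpa using hz'

theorem IsPrimeLoad.exists_loadOrder_eq {n : ℕ} {r : Fin n ⊕ Fin n → Fin n ⊕ Fin n → Prop}
    (hr : IsPrimeLoad (fun a => a.isRight = true) r) :
    ∃ (T : LabeledRootedTree n) (s : Fin n → Fin n), T.loadOrder s = r := by
  classical
  obtain ⟨t, ht⟩ := hr.tree.exists_top
  obtain ⟨ρ, rfl⟩ : ∃ ρ, t = Sum.inl ρ := by
    rcases t with t | t
    · exact ⟨t, rfl⟩
    · exact (hr.not_top _ rfl ht).elim
  -- Drivers are minimal, so the least strict ancestor of any node is a spot; it serves as parent of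
  -- a spot and as preference of a driver.
  have hcover (x : Fin n ⊕ Fin n) (hx : x ≠ Sum.inl ρ) :
      ∃ y : Fin n, r x (Sum.inl y) ∧ Sum.inl y ≠ x ∧ ∀ z, r x z → z ≠ x → r (Sum.inl y) z := by
    obtain ⟨y | y, h1, h2, h3⟩ :=
      hr.tree.exists_cover fun h => hx (hr.tree.antisymm _ _ (ht x) (h _))
    · exact ⟨y, h1, h2, h3⟩
    · exact (h2 (hr.minimal _ rfl _ h1).symm).elim
  have : Nonempty (Fin n) := ⟨ρ⟩
  choose! q hq1 hq2 hq3 using hcover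
  let p : Fin n → Fin n := fun a => if a = ρ then ρ else q (Sum.inl a)
  have hp (a : Fin n) (ha : a ≠ ρ) : p a = q (Sum.inl a) := if_neg ha
  have hpρ : p ρ = ρ := if_pos rfl
  have hup (a : Fin n) : r (Sum.inl a) (Sum.inl (p a)) := by
    by_cases ha : a = ρ
    · rw [ha, hpρ]
      exact ht _
    · rw [hp a ha]
      exact hq1 _ (by simpa using ha)
  have hiter (k : ℕ) (a : Fin n) : r (Sum.inl a) (Sum.inl (p^[k] a)) := by
    induction k with
    | zero => exact hr.tree.refl _
    | succ k ih =>
      rw [Function.iterate_succ_apply']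
      exact hr.tree.trans _ _ _ ih (hup _)
  -- Induction on the number of nodes above `a`, which drops on passing to `p a`.
  have hreach (m : ℕ) : ∀ a b, (Finset.univ.filter fun x => r (Sum.inl a) x).card = m →
      r (Sum.inl a) (Sum.inl b) → ∃ k, p^[k] a = b := by
    induction m using Nat.strong_induction_on with
    | _ m ih =>
      intro a b hm hab
      by_cases hne : a = b
      · exact ⟨0, hne⟩
      have ha : a ≠ ρ := by
        rintro rfl
        exact hne (Sum.inl.inj (hr.tree.antisymm _ _ hab (ht _)))
      have ha' : (Sum.inl a : Fin n ⊕ Fin n) ≠ Sum.inl ρ := by simpa using ha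
      have hsub : (Finset.univ.filter fun x => r (Sum.inl (p a)) x) ⊂
          Finset.univ.filter fun x => r (Sum.inl a) x := by
        refine (Finset.ssubset_iff_of_subset fun x => ?_).2 ⟨Sum.inl a, ?_, ?_⟩
        · simpa using hr.tree.trans _ _ _ (hup a)
        · simpa using hr.tree.refl _
        · simp only [Finset.mem_filter, Finset.mem_univ, true_and]
          intro h
          rw [hp a ha] at h
          exact hq2 _ ha' (hr.tree.antisymm _ _ h (hq1 _ ha'))
      obtain ⟨k, hk⟩ := ih _ (hm ▸ Finset.card_lt_card hsub) (p a) b rfl (by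
        rw [hp a ha]
        exact hq3 _ ha' _ hab (by simpa using Ne.symm hne))
      exact ⟨k + 1, hk⟩
  let T : LabeledRootedTree n := ⟨ρ, p, hpρ, fun v => hreach _ v ρ rfl (ht _)⟩
  have hbelow (a b : Fin n) : T.Below a b ↔ r (Sum.inl a) (Sum.inl b) := by
    refine ⟨?_, hreach _ a b rfl⟩
    rintro ⟨k, rfl⟩
    exact hiter k a
  refine ⟨T, fun d => q (Sum.inr d), ?_⟩
  ext (a | d) (b | e)
  · exact hbelow a b
  · exact ⟨False.elim, fun h => Sum.inl_ne_inr (hr.minimal _ rfl _ h)⟩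
  · refine (hbelow _ _).trans ⟨hr.tree.trans _ _ _ (hq1 _ (by simp)), fun h => ?_⟩
    exact hq3 _ (by simp) _ h (by simp)
  · refine ⟨?_, fun h => Sum.inr.inj (hr.minimal _ rfl _ h)⟩
    rintro rfl
    exact hr.tree.refl _

/-- Prime parking functions on trees are prime loads with `n` spots and `n` drivers. -/
noncomputable def primeParkingFunctionsEquiv (n : ℕ) : primeParkingFunctions n ≃
    {r : Fin n ⊕ Fin n → Fin n ⊕ Fin n → Prop // IsPrimeLoad (fun a => a.isRight = true) r} :=
  Equiv.ofBijective
    (fun x => ⟨x.1.1.loadOrder x.1.2,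
      LabeledRootedTree.isPrimeParkingFunction_iff_isPrimeLoad.1 x.2⟩) <| by
    constructor
    · intro x y hxy
      obtain ⟨h1, h2⟩ := LabeledRootedTree.loadOrder_injective (Subtype.ext_iff.1 hxy)
      exact Subtype.ext (Prod.ext h1 h2)
    · rintro ⟨r, hr⟩
      obtain ⟨T, s, rfl⟩ := hr.exists_loadOrder_eq
      exact ⟨⟨(T, s), LabeledRootedTree.isPrimeParkingFunction_iff_isPrimeLoad.2 hr⟩, rfl⟩

theorem theorem1p3 (n : ℕ) (hn : 1 ≤ n) :
    (primeParkingFunctions n).Finite ∧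
    (primeParkingFunctions n).ncard = Nat.factorial (2 * n - 2) ∧
    (∀ (T : LabeledRootedTree n) (s : Fin n → Fin n), T.IsParkingFunction s →
      (T.IsPrimeParkingFunction s ↔ ∀ u : Fin n, u ≠ T.root → T.EdgeUsed s u)) := by
  refine ⟨?_, ?_, fun T s hs => hs.isPrimeParkingFunction_iff⟩
  · exact Finite.of_equiv _ (primeParkingFunctionsEquiv n).symm
  · rw [← numPrimeLoad_self n hn, ← Nat.card_coe_set_eq]
    exact Nat.card_congr (primeParkingFunctionsEquiv n)
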